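/- Let $f:\mathbb{R}^n\to\mathbb{R}^n$ be $C^3$ with $f(x^*)=0$. Put $N=\operatorname{null} f'(x^*)$ and $R=\operatorname{range} f'(x^*)$, assume $\dim N=1$ and $R\perp N$, and let $P_N,P_R$ be the orthogonal projections onto $N$ and $R$. Let $0\neq\varphi\in N$ and assume that $\hat D(\cdot)=P_Nf''(x^*)(\varphi,P_N\,\cdot)$ is invertible as a map $N\to N$. Fix $\hat r\in(0,1)$. For a starting point $x_0$, the adaptive $\gamma$-safeguarded Newton–Anderson iteration is as follows: $w_{k+1}=-f'(x_k)^{-1}f(x_k)$ for $k\ge 0$, $x_1=x_0+w_1$, and for $k\ge1$ $$x_{k+1}=x_k+w_{k+1}-\lambda_{k+1}\gamma_{k+1}(x_k-x_{k-1}+w_{k+1}-w_k),\qquad \gamma_{k+1}=\frac{(w_{k+1}-w_k)^Tw_{k+1}}{\|w_{k+1}-w_k\|^2},$$ where, with $\eta_{k+1}=\|w_{k+1}\|/\|w_k\|$ and $\beta_{k+1}=\min\{\eta_{k+1},\hat r\}\,\eta_{k+1}$: $\lambda_{k+1}=0$ if $\gamma_{k+1}=0$ or $\gamma_{k+1}\ge1$;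 otherwise $\lambda_{k+1}=\dfrac{\beta_{k+1}}{\gamma_{k+1}(\beta_{k+1}+\operatorname{sign}\gamma_{k+1})}$ if $|\gamma_{k+1}|/|1-\gamma_{k+1}|>\beta_{k+1}$; and $\lambda_{k+1}=1$ in all other cases. Norms are Euclidean. Put $e_k=x_k-x^*$, $\sigma_k=\|P_Re_k\|/\|P_Ne_k\|$, $\theta^\lambda_{k+1}=\|w_{k+1}-\lambda_{k+1}\gamma_{k+1}(w_{k+1}-w_k)\|/\|w_{k+1}\|$, and for $\rho,s\geq 0$ $$W(\rho,s)=B_\rho(x^*)\cap\{x:\|P_R(x-x^*)\|<s\|P_N(x-x^*)\|\},\qquad W_k=W(\|e_k\|,\sigma_k),$$ with $B_\rho(x^*)$ the open ball. Then there are constants $\hat\sigma,\hat\rho,C,c>0$ and $\kappa\in(1/2,1)$ such that $f'(x)$ is invertible for all $x\in\hat W:=W(\hat\rho,\hat\sigma)$ and, for every $x_0$ with $P_Ne_0\ne0$, $\sigma_0<\hat\sigma$ and $\|e_0\|<\hat\rho$: 1. the iteration is well defined: for all $k\ge0$, $x_k\in\hat W$, $f'(x_k)$ is invertible, $P_Ne_k\neq0$,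 $w_{k+1}\ne0$ and $w_{k+2}\neq w_{k+1}$; 2. $W_{k+1}\subset W(\|e_0\|,\hat\sigma)\subset\hat W$ for all $k\ge0$; and if $\|e_0\|\le c\,\sigma_0$ (that is, $\|e_0\|$ is small relative to $\sigma_0$), then $W_{k+1}\subset W_0$ for all $k\geq0$; 3. $x_k\to x^*$; 4. for all $k\ge1$, $$\|P_Re_{k+1}\|\le C\max\{|1-\lambda_{k+1}\gamma_{k+1}|\,\|e_k\|^2,\ |\lambda_{k+1}\gamma_{k+1}|\,\|e_{k-1}\|^2\},\qquad \|P_Ne_{k+1}\|\le\kappa\,\theta^\lambda_{k+1}\,\|P_Ne_k\|.$$ -/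

import Mathlib

open Filter Topology

noncomputable section

namespace NewtonAnderson

variable {n : ℕ}

/-- The null space `N` of the derivative `f'(xs)`. -/
abbrev nullSp (f : EuclideanSpace ℝ (Fin n) → EuclideanSpace ℝ (Fin n))
    (xs : EuclideanSpace ℝ (Fin n)) : Submodule ℝ (EuclideanSpace ℝ (Fin n)) :=
  LinearMap.ker (fderiv ℝ f xs).toLinearMap

/-- The range `R` of the derivative `f'(xs)`. -/
abbrev rangeSp (f : EuclideanSpace ℝ (Fin n) → EuclideanSpace ℝ (Fin n))
    (xs : EuclideanSpace ℝ (Fin n)) : Submodule ℝ (EuclideanSpace ℝ (Fin n)) :=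
  LinearMap.range (fderiv ℝ f xs).toLinearMap

/-- The orthogonal projection `P_N`, as an operator on the whole space. -/
def projN (f : EuclideanSpace ℝ (Fin n) → EuclideanSpace ℝ (Fin n))
    (xs : EuclideanSpace ℝ (Fin n)) :
    EuclideanSpace ℝ (Fin n) →L[ℝ] EuclideanSpace ℝ (Fin n) :=
  (nullSp f xs).starProjection

/-- The orthogonal projection `P_R`, as an operator on the whole space. -/
def projR (f : EuclideanSpace ℝ (Fin n) → EuclideanSpace ℝ (Fin n))
    (xs : EuclideanSpace ℝ (Fin n)) :
    EuclideanSpace ℝ (Fin n) →L[ℝ] EuclideanSpace ℝ (Fin n) :=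
  (rangeSp f xs).starProjection

/-- The operator `D̂ = P_N f''(xs)(φ, P_N ·)` as a map from `N` to `N`
(on `N` the inner `P_N` is the identity). -/
def Dhat (f : EuclideanSpace ℝ (Fin n) → EuclideanSpace ℝ (Fin n))
    (xs φ : EuclideanSpace ℝ (Fin n)) : nullSp f xs →L[ℝ] nullSp f xs :=
  (nullSp f xs).orthogonalProjectionOnto ∘L
    (fderiv ℝ (fderiv ℝ f) xs φ) ∘L (nullSp f xs).subtypeL

/-- The Newton update `-f'(x)⁻¹ f(x)`; it is meaningful when `f'(x)` is invertible. -/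
def newtonUpdate (f : EuclideanSpace ℝ (Fin n) → EuclideanSpace ℝ (Fin n))
    (x : EuclideanSpace ℝ (Fin n)) : EuclideanSpace ℝ (Fin n) :=
  -((fderiv ℝ f x).inverse (f x))

/-- The Anderson coefficient `γ` of two successive updates `w` (older) and `w'` (newer);
it is meaningful when `w' ≠ w`. -/
def anderson (w w' : EuclideanSpace ℝ (Fin n)) : ℝ :=
  inner ℝ (w' - w) w' / ‖w' - w‖ ^ 2

/-- `β = r η` with `η = ‖w'‖ / ‖w‖` and `r = min {η, rhat}`. -/
def safeguardTol (rhat : ℝ) (w w' : EuclideanSpace ℝ (Fin n)) : ℝ :=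
  min (‖w'‖ / ‖w‖) rhat * (‖w'‖ / ‖w‖)

open Classical in
/-- The factor `λ` computed by adaptive `γ`-safeguarding. -/
def safeguardFactor (rhat : ℝ) (w w' : EuclideanSpace ℝ (Fin n)) : ℝ :=
  if anderson w w' = 0 ∨ 1 ≤ anderson w w' then 0
  else if safeguardTol rhat w w' < |anderson w w'| / |1 - anderson w w'| then
    safeguardTol rhat w w' /
      (anderson w w' * (safeguardTol rhat w w' + Real.sign (anderson w w')))
  else 1

/-- The safeguarded coefficient `λ γ`, for the successive iterates `xp` (older) and `x` (newer). -/
def lamGamma (f : EuclideanSpace ℝ (Fin n) → EuclideanSpace ℝ (Fin n)) (rhat : ℝ)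
    (xp x : EuclideanSpace ℝ (Fin n)) : ℝ :=
  safeguardFactor rhat (newtonUpdate f xp) (newtonUpdate f x) *
    anderson (newtonUpdate f xp) (newtonUpdate f x)

/-- The gain `θ^λ = ‖w' - λ γ (w' - w)‖ / ‖w'‖`, for the successive iterates `xp` and `x`. -/
def gain (f : EuclideanSpace ℝ (Fin n) → EuclideanSpace ℝ (Fin n)) (rhat : ℝ)
    (xp x : EuclideanSpace ℝ (Fin n)) : ℝ :=
  ‖newtonUpdate f x - lamGamma f rhat xp x • (newtonUpdate f x - newtonUpdate f xp)‖ /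
    ‖newtonUpdate f x‖

/-- The iterates `x_k` of adaptive `γ`-safeguarded Newton–Anderson, started at `x0`. -/
def iter (f : EuclideanSpace ℝ (Fin n) → EuclideanSpace ℝ (Fin n)) (rhat : ℝ)
    (x0 : EuclideanSpace ℝ (Fin n)) : ℕ → EuclideanSpace ℝ (Fin n)
  | 0 => x0
  | 1 => x0 + newtonUpdate f x0
  | k + 2 =>
      iter f rhat x0 (k + 1) + newtonUpdate f (iter f rhat x0 (k + 1))
        - lamGamma f rhat (iter f rhat x0 k) (iter f rhat x0 (k + 1)) •
          (iter f rhat x0 (k + 1) - iter f rhat x0 k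
            + newtonUpdate f (iter f rhat x0 (k + 1)) - newtonUpdate f (iter f rhat x0 k))

/-- `σ(x) = ‖P_R (x - xs)‖ / ‖P_N (x - xs)‖`; it is meaningful when `P_N (x - xs) ≠ 0`. -/
def sigma (f : EuclideanSpace ℝ (Fin n) → EuclideanSpace ℝ (Fin n))
    (xs x : EuclideanSpace ℝ (Fin n)) : ℝ :=
  ‖projR f xs (x - xs)‖ / ‖projN f xs (x - xs)‖

/-- `B_ρ(xs) ∩ {x : ‖P_R (x - xs)‖ < s ‖P_N (x - xs)‖}`. -/
def region (f : EuclideanSpace ℝ (Fin n) → EuclideanSpace ℝ (Fin n))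
    (xs : EuclideanSpace ℝ (Fin n)) (ρ s : ℝ) : Set (EuclideanSpace ℝ (Fin n)) :=
  Metric.ball xs ρ ∩ {x | ‖projR f xs (x - xs)‖ < s * ‖projN f xs (x - xs)‖}

/-- `W(x) = B_{‖x - xs‖}(xs) ∩ {y : ‖P_R (y - xs)‖ < σ(x) ‖P_N (y - xs)‖}`,
so that `W_k = W(x_k)`. -/
def regionAt (f : EuclideanSpace ℝ (Fin n) → EuclideanSpace ℝ (Fin n))
    (xs x : EuclideanSpace ℝ (Fin n)) : Set (EuclideanSpace ℝ (Fin n)) :=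
  region f xs ‖x - xs‖ (sigma f xs x)

end NewtonAnderson

end

/-! ### Taylor expansion and perturbation of a singular linear operator -/

namespace NewtonAnderson

variable {E : Type*} [NormedAddCommGroup E] [NormedSpace ℝ E]

/-! Write `P`, `Q` for the projections onto `N` and `R`. On a thin cone around `N`, `f'(x)` is close
to `A + B e`, where `A = f'(xs)`, `B = f''(xs)` and `e = x - xs`. `A` is bounded below on `R`, and
invertibility of `D̂` with `dim N = 1` bounds `P B(P e, P v)` below by a multiple of `‖P e‖ ‖P v‖`.
Hence `f'(x)` is invertible there (`perturbed_injective`), and a Newton step sends `P e` to `P e /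
2` up to a relative error `ε`, and `Q e` to something `O(‖e‖ ^ 2)` (`newton_error`,
`exists_newton_estimate`).

With `μ = λ γ`, the accelerated error is `(1 - μ) (e' + w') + μ (e + w)`, a combination of two
Newton errors. The safeguard gives `|μ| ≤ β |1 - μ|` and `β ‖w‖ ≤ rhat ‖w'‖`
(`safeguardFactor_spec`, `safeguardTol_mul_norm_le`). So in `N` the older term is at most about
`rhat < 1` times the newer one: they cannot cancel, and the new kernel part is at least a multiple
of `(1 - rhat) |1 - μ| ‖P e'‖`. The range part is quadratically small with the same weights, so the
new aperture is at most `K ‖e_0‖` and the iterates never leave the cone.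

For the upper bound, `P (e + w) = -P w + 2 δ` with `‖δ‖ ≤ ε ‖P e‖`, so the new kernel error is, up
to `δ`-terms, the projected Anderson residual, of norm `θ ‖w'‖` with `‖w'‖` about `‖P e'‖ / 2`. As
`θ ≥ (1 - rhat) |1 - μ|`, taking `ε` proportional to `1 - rhat` absorbs the `δ`-terms
(`anderson_step`). Finally `θ ≤ 1`, because `γ` minimizes the residual and `λ ∈ [0, 1]`; this gives
geometric decay. -/

/-- Second-order Taylor expansion of a map and first-order expansion of its derivative. -/
theorem taylor_two {f : E → E} (hf : ContDiff ℝ 2 f) (xs : E) {δ : ℝ} (hδ : 0 < δ) :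
    ∃ ρ > 0, ∀ x, ‖x - xs‖ < ρ →
      ‖fderiv ℝ f x - fderiv ℝ f xs - fderiv ℝ (fderiv ℝ f) xs (x - xs)‖ ≤ δ * ‖x - xs‖ ∧
      ‖f x - f xs - fderiv ℝ f xs (x - xs)
        - (1 / 2 : ℝ) • fderiv ℝ (fderiv ℝ f) xs (x - xs) (x - xs)‖ ≤ δ * ‖x - xs‖ ^ 2 := by
  have hd : Differentiable ℝ f := hf.differentiable (by norm_num)
  have hd2 : Differentiable ℝ (fderiv ℝ f) :=
    (hf.fderiv_right (m := 1) (by norm_num)).differentiable (by norm_num)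
  have hsymm : IsSymmSndFDerivAt ℝ f xs := hf.contDiffAt.isSymmSndFDerivAt (by simp)
  have ho := (hasFDerivAt_iff_isLittleO.1 (hd2 xs).hasFDerivAt).def hδ
  obtain ⟨ρ, hρ, hball⟩ := Metric.eventually_nhds_iff_ball.1 ho
  have hfirst : ∀ y, ‖y - xs‖ < ρ →
      ‖fderiv ℝ f y - fderiv ℝ f xs - fderiv ℝ (fderiv ℝ f) xs (y - xs)‖ ≤ δ * ‖y - xs‖ :=
    fun y hy => hball y (by simpa [dist_eq_norm] using hy)
  refine ⟨ρ, hρ, fun x hx => ⟨hfirst x hx, ?_⟩⟩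
  set B := fderiv ℝ (fderiv ℝ f) xs with hB
  -- By symmetry of `B`, the derivative of this remainder is the first-order remainder of `f'`, so
  -- the mean value inequality on the ball of radius `‖x - xs‖` gives the second bound.
  let h : E → E := fun y => f y - fderiv ℝ f xs (y - xs) - (1 / 2 : ℝ) • B (y - xs) (y - xs)
  have hderiv : ∀ y, HasFDerivAt h (fderiv ℝ f y - fderiv ℝ f xs - B (y - xs)) y := by
    intro y
    have h1 : HasFDerivAt (fun y : E => y - xs) (ContinuousLinearMap.id ℝ E) y :=
      (hasFDerivAt_id y).sub_const xs
    have h2 : HasFDerivAt (fun y : E => fderiv ℝ f xs (y - xs)) (fderiv ℝ f xs) y := by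
      exact (fderiv ℝ f xs).hasFDerivAt.comp y h1
    have h3 : HasFDerivAt (fun y : E => B (y - xs)) B y := by
      exact B.hasFDerivAt.comp y h1
    have h4 := (h3.clm_apply h1).const_smul (1 / 2 : ℝ)
    have h5 := ((hd y).hasFDerivAt.sub h2).sub h4
    refine h5.congr_fderiv ?_
    ext v
    have hs : B v (y - xs) = B (y - xs) v := hsymm v (y - xs)
    simp only [sub_apply, smul_apply,
      add_apply, ContinuousLinearMap.comp_apply,
      ContinuousLinearMap.flip_apply, ContinuousLinearMap.id_apply, hs]
    rw [← two_smul ℝ, smul_smul]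
    norm_num
  have hseg := (convex_closedBall xs ‖x - xs‖).norm_image_sub_le_of_norm_hasFDerivWithin_le
    (f := h) (C := δ * ‖x - xs‖) (x := xs) (y := x)
    (fun y _ => (hderiv y).hasFDerivWithinAt)
    (fun y hy => by
      have hy' : ‖y - xs‖ ≤ ‖x - xs‖ := by simpa [dist_eq_norm] using hy
      exact (hfirst y (hy'.trans_lt hx)).trans (by gcongr))
    (by simp) (by simp [dist_eq_norm])
  calc _ = ‖h x - h xs‖ := by simp only [h]; congr 1; simp; abel
    _ ≤ _ := hseg
    _ = _ := by ring

/-- A linear operator `L` near a degenerate `A` along the direction `e`, with bilinear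
correction `B e`, is controlled from below on the range and kernel parts. -/
theorem perturbed_lower_bound (A L P Q : E →L[ℝ] E) (B : E →L[ℝ] E →L[ℝ] E)
    (hPQ : ∀ v, P v + Q v = v) (hP : ∀ v, ‖P v‖ ≤ ‖v‖) (hQ : ∀ v, ‖Q v‖ ≤ ‖v‖)
    (hPA : ∀ v, P (A v) = 0) (hQA : ∀ v, Q (A v) = A v) {m d K : ℝ} (hm : 0 < m) (hK : 0 ≤ K)
    (hA : ∀ v, m * ‖Q v‖ ≤ ‖A v‖) (hB : ∀ u v, ‖B u v‖ ≤ K * ‖u‖ * ‖v‖)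
    (hd : ∀ u v, d * ‖P u‖ * ‖P v‖ ≤ ‖P (B (P u) (P v))‖)
    {t : ℝ} (ht : 0 ≤ t) (ht1 : t ≤ 1) (htm : 4 * (K + 1) * t ≤ m)
    (htd : (2 + K + (3 * K + 2) * (4 * (K + 1)) / m) * t ≤ d / 2)
    {e : E} (hL : ∀ v, ‖L v - A v - B e v‖ ≤ t * ‖e‖ * ‖v‖) (heP : ‖P e‖ ≤ t)
    (heQ : ‖Q e‖ ≤ t * ‖P e‖) (v : E) :
    m * ‖Q v‖ ≤ 2 * ‖Q (L v)‖ + 4 * (K + 1) * ‖P e‖ * ‖P v‖ ∧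
    d * ‖P e‖ * ‖P v‖ ≤ 2 * ‖P (L v)‖ + 2 * ((6 * K + 4) / m) * ‖P e‖ * ‖Q (L v)‖ := by
  have hv : ‖v‖ ≤ ‖P v‖ + ‖Q v‖ := by
    conv_lhs => rw [← hPQ v]
    exact norm_add_le _ _
  have he : ‖e‖ ≤ 2 * ‖P e‖ := by
    have h1 : ‖e‖ ≤ ‖P e‖ + ‖Q e‖ := by
      conv_lhs => rw [← hPQ e]
      exact norm_add_le _ _
    nlinarith [norm_nonneg (P e)]
  set a := ‖P e‖ with ha
  set b := ‖P v‖ with hb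
  set q := ‖Q v‖ with hq
  have ha0 : 0 ≤ a := norm_nonneg _
  have hb0 : 0 ≤ b := norm_nonneg _
  have hq0 : 0 ≤ q := norm_nonneg _
  have hY0 : 0 ≤ ‖Q (L v)‖ := norm_nonneg _
  have hev : ‖e‖ * ‖v‖ ≤ 2 * a * (b + q) := by
    calc ‖e‖ * ‖v‖ ≤ (2 * a) * (b + q) := by gcongr
      _ = _ := by ring
  -- Range part: `A v` is the only term that is not small in `e`. The `q` on the right is absorbed
  -- next through `4 (K + 1) t ≤ m`.
  have hR : m * q ≤ ‖Q (L v)‖ + 2 * (K + 1) * a * (b + q) := by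
    have h1 : A v = Q (L v) - Q (L v - A v - B e v) - Q (B e v) := by
      simp only [map_sub, hQA]; abel
    have h2 : ‖A v‖ ≤ ‖Q (L v)‖ + ‖L v - A v - B e v‖ + ‖B e v‖ := by
      refine (congrArg norm h1).trans_le ((norm_sub_le _ _).trans
        (add_le_add ((norm_sub_le _ _).trans ?_) (hQ _)))
      gcongr
      exact hQ _
    have h3 := hA v
    have h4 := hL v
    have h5 := hB e v
    nlinarith [mul_nonneg (norm_nonneg e) (norm_nonneg v)]
  have hR' : m * q ≤ 2 * ‖Q (L v)‖ + 4 * (K + 1) * a * b := by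
    have h1 : 4 * (K + 1) * a * q ≤ m * q := by
      gcongr
      exact (mul_le_mul_of_nonneg_left heP (by positivity)).trans htm
    nlinarith
  refine ⟨hR', ?_⟩
  -- Kernel part: `P A = 0`, so the leading term is `P B(P e, P v)`. The `q` left over is then
  -- replaced by its range bound.
  have hN : d * a * b ≤ ‖P (L v)‖ + (2 + K) * t * a * (b + q) + 2 * K * a * q := by
    have h1 : P (B (P e) (P v)) =
        P (L v) - P (L v - A v - B e v) - P (B (Q e) v) - P (B (P e) (Q v)) := by
      have h2 : B e v = B (P e) (P v) + B (P e) (Q v) + B (Q e) v := by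
        rw [← map_add, hPQ, ← add_apply, ← map_add, hPQ]
      rw [map_sub, map_sub, hPA, h2]
      simp only [map_add]; abel
    have h2 : ‖P (B (P e) (P v))‖ ≤
        ‖P (L v)‖ + ‖L v - A v - B e v‖ + ‖B (Q e) v‖ + ‖B (P e) (Q v)‖ := by
      rw [h1]
      refine (norm_sub_le _ _).trans (add_le_add ((norm_sub_le _ _).trans
        (add_le_add ((norm_sub_le _ _).trans ?_) (hP _))) (hP _))
      gcongr
      exact hP _
    have h3 := hL v
    have h4 : ‖B (Q e) v‖ ≤ K * (t * a) * (b + q) :=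
      (hB _ _).trans (by gcongr)
    have h5 : ‖B (P e) (Q v)‖ ≤ K * a * q := hB _ _
    have h6 := hd e v
    have h7 : t * ‖e‖ * ‖v‖ ≤ t * (2 * a * (b + q)) := by
      rw [mul_assoc]; gcongr
    have h8 : 0 ≤ K * a * q := by positivity
    linarith
  have hqb : q ≤ (2 * ‖Q (L v)‖ + 4 * (K + 1) * a * b) / m := by
    rw [le_div_iff₀ hm]; linarith
  have h1 : (2 + K) * t * a * q ≤ (2 + K) * a * q := by
    have : 0 ≤ (2 + K) * a * q * (1 - t) := mul_nonneg (by positivity) (by linarith)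
    linarith
  have h2 : (3 * K + 2) * a * q ≤
      (3 * K + 2) * a * ((2 * ‖Q (L v)‖ + 4 * (K + 1) * a * b) / m) := by gcongr
  have h3 : (3 * K + 2) * a * ((2 * ‖Q (L v)‖ + 4 * (K + 1) * a * b) / m) =
      ((6 * K + 4) / m) * a * ‖Q (L v)‖ + ((3 * K + 2) * (4 * (K + 1)) / m) * a * (a * b) := by
    field_simp; ring
  have h4 : ((3 * K + 2) * (4 * (K + 1)) / m) * a * (a * b) ≤
      ((3 * K + 2) * (4 * (K + 1)) / m) * t * (a * b) := by gcongr
  have h5 : (2 + K + (3 * K + 2) * (4 * (K + 1)) / m) * t * (a * b) ≤ d / 2 * (a * b) := by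
    gcongr
  nlinarith

/-- Error of one Newton step `v = e + w` at a point with error `e`, at a singular root. -/
theorem newton_error (A L P Q : E →L[ℝ] E) (B : E →L[ℝ] E →L[ℝ] E)
    (hPQ : ∀ v, P v + Q v = v) (hP : ∀ v, ‖P v‖ ≤ ‖v‖) (hQ : ∀ v, ‖Q v‖ ≤ ‖v‖)
    (hPA : ∀ v, P (A v) = 0) (hQA : ∀ v, Q (A v) = A v) (hAP : ∀ v, A (P v) = 0)
    {m d K : ℝ} (hm : 0 < m) (hd0 : 0 < d) (hK : 0 ≤ K)
    (hA : ∀ v, m * ‖Q v‖ ≤ ‖A v‖) (hAK : ∀ v, ‖A v‖ ≤ K * ‖v‖)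
    (hB : ∀ u v, ‖B u v‖ ≤ K * ‖u‖ * ‖v‖)
    (hd : ∀ u v, d * ‖P u‖ * ‖P v‖ ≤ ‖P (B (P u) (P v))‖)
    {t : ℝ} (ht : 0 ≤ t) (ht1 : t ≤ 1) (htm : 4 * (K + 1) * t ≤ m)
    (htd : (2 + K + (3 * K + 2) * (4 * (K + 1)) / m) * t ≤ d / 2)
    {ε : ℝ} (hε : ε ≤ 1 / 2) (htε : (12 + 2 * ((6 * K + 4) / m) * (K + 6)) * t ≤ d * ε)
    {e fx w : E} (hL : ∀ v, ‖L v - A v - B e v‖ ≤ t * ‖e‖ * ‖v‖)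
    (hfx : ‖fx - A e - (1 / 2 : ℝ) • B e e‖ ≤ t * ‖e‖ ^ 2) (hw : L w = -fx)
    (heP0 : P e ≠ 0) (heP : ‖P e‖ ≤ t) (heQ : ‖Q e‖ ≤ t * ‖P e‖) :
    ‖P (e + w) - (1 / 2 : ℝ) • P e‖ ≤ ε * ‖P e‖ ∧
    ‖Q (e + w)‖ ≤ (6 * K + 8) / m * ‖e‖ ^ 2 := by
  have key := perturbed_lower_bound A L P Q B hPQ hP hQ hPA hQA hm hK hA hB hd ht ht1 htm htd
    hL heP heQ
  have ha0 : 0 < ‖P e‖ := norm_pos_iff.2 heP0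
  have he : ‖e‖ ≤ 2 * ‖P e‖ := by
    have h1 : ‖e‖ ≤ ‖P e‖ + ‖Q e‖ := by
      conv_lhs => rw [← hPQ e]
      exact norm_add_le _ _
    nlinarith
  have hLe : ‖L e - A e - B e e‖ ≤ t * ‖e‖ ^ 2 := (hL e).trans_eq (by ring)
  set g := (1 / 2 : ℝ) • (L e - A e - B e e) - (fx - A e - (1 / 2 : ℝ) • B e e) with hg
  have hgn : ‖g‖ ≤ 6 * t * ‖P e‖ ^ 2 := by
    have h1 : ‖g‖ ≤ 1 / 2 * ‖L e - A e - B e e‖ + ‖fx - A e - (1 / 2 : ℝ) • B e e‖ := by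
      refine (norm_sub_le _ _).trans ?_
      rw [norm_smul]; norm_num
    have h2 : t * ‖e‖ ^ 2 ≤ t * (2 * ‖P e‖) ^ 2 := by gcongr
    nlinarith
  have hPpart : ‖P (e + w) - (1 / 2 : ℝ) • P e‖ ≤ ε * ‖P e‖ := by
    -- This is where the factor `1/2` arises: in `L e / 2 - fx` the two terms `B e e / 2` cancel.
    -- The remaining `A e / 2` is killed by `P`, and it is small because `A e = A (Q e)`.
    have hz : L (e + w - (1 / 2 : ℝ) • e) = g - (1 / 2 : ℝ) • A e := by
      rw [map_sub, map_add, map_smul, hw, hg]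
      module
    have hk := (key (e + w - (1 / 2 : ℝ) • e)).2
    rw [hz] at hk
    have hPz : ‖P (g - (1 / 2 : ℝ) • A e)‖ ≤ 6 * t * ‖P e‖ ^ 2 := by
      rw [map_sub, map_smul, hPA, smul_zero, sub_zero]
      exact (hP _).trans hgn
    have hAe : ‖A e‖ ≤ K * (t * ‖P e‖) := by
      have : A e = A (Q e) := by
        conv_lhs => rw [← hPQ e, map_add, hAP, zero_add]
      rw [this]
      exact (hAK _).trans (by gcongr)
    have hQz : ‖Q (g - (1 / 2 : ℝ) • A e)‖ ≤ (K + 6) * t * ‖P e‖ := by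
      refine (hQ _).trans ((norm_sub_le _ _).trans ?_)
      rw [norm_smul]
      have : 6 * t * ‖P e‖ ^ 2 ≤ 6 * t * ‖P e‖ := by
        have : ‖P e‖ ^ 2 ≤ ‖P e‖ := by nlinarith
        gcongr
      norm_num
      nlinarith [norm_nonneg (A e)]
    have hk2 : d * ‖P e‖ * ‖P (e + w - (1 / 2 : ℝ) • e)‖ ≤
        2 * (6 * t * ‖P e‖ ^ 2)
          + 2 * ((6 * K + 4) / m) * ‖P e‖ * ((K + 6) * t * ‖P e‖) := by
      refine hk.trans ?_
      gcongr
    have hk3 : 2 * (6 * t * ‖P e‖ ^ 2)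
          + 2 * ((6 * K + 4) / m) * ‖P e‖ * ((K + 6) * t * ‖P e‖) =
        (12 + 2 * ((6 * K + 4) / m) * (K + 6)) * t * ‖P e‖ ^ 2 := by ring
    have hk4 : d * ‖P e‖ * ‖P (e + w - (1 / 2 : ℝ) • e)‖ ≤ d * ‖P e‖ * (ε * ‖P e‖) := by
      refine (hk2.trans_eq hk3).trans ?_
      calc _ ≤ d * ε * ‖P e‖ ^ 2 := by gcongr
        _ = _ := by ring
    have := le_of_mul_le_mul_left hk4 (by positivity)
    simpa only [map_sub, map_smul] using this
  refine ⟨hPpart, ?_⟩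
  -- In `L e - fx` the linear term `A e` cancels, so everything left is quadratic in `e`.
  have hLv : L (e + w) = (L e - A e - B e e) - (fx - A e - (1 / 2 : ℝ) • B e e)
      + (1 / 2 : ℝ) • B e e := by
    rw [map_add, hw]; module
  have hLvn : ‖Q (L (e + w))‖ ≤ (K + 2) * ‖e‖ ^ 2 := by
    refine (hQ _).trans ?_
    rw [hLv]
    have h1 := norm_add_le ((L e - A e - B e e) - (fx - A e - (1 / 2 : ℝ) • B e e))
      ((1 / 2 : ℝ) • B e e)
    have h2 := norm_sub_le (L e - A e - B e e) (fx - A e - (1 / 2 : ℝ) • B e e)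
    have h3 : ‖(1 / 2 : ℝ) • B e e‖ ≤ K * ‖e‖ ^ 2 := by
      rw [norm_smul]
      have := hB e e
      norm_num
      nlinarith [norm_nonneg (B e e)]
    have h4 : t * ‖e‖ ^ 2 ≤ 1 * ‖e‖ ^ 2 := by gcongr
    linarith
  have hPv : ‖P (e + w)‖ ≤ ‖P e‖ := by
    have h1 : ‖P (e + w)‖ ≤ ‖P (e + w) - (1 / 2 : ℝ) • P e‖ + ‖(1 / 2 : ℝ) • P e‖ := by
      simpa using norm_add_le (P (e + w) - (1 / 2 : ℝ) • P e) ((1 / 2 : ℝ) • P e)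
    rw [norm_smul, Real.norm_of_nonneg (by norm_num)] at h1
    nlinarith
  have hk := (key (e + w)).1
  rw [div_mul_eq_mul_div, le_div_iff₀ hm]
  have h1 : 4 * (K + 1) * ‖P e‖ * ‖P (e + w)‖ ≤ 4 * (K + 1) * ‖e‖ * ‖e‖ := by
    gcongr
    · exact hP e
    · exact hPv.trans (hP e)
  nlinarith

/-- Injectivity of the perturbed operator under the hypotheses of `perturbed_lower_bound`. -/
theorem perturbed_injective (A L P Q : E →L[ℝ] E) (B : E →L[ℝ] E →L[ℝ] E)
    (hPQ : ∀ v, P v + Q v = v) (hP : ∀ v, ‖P v‖ ≤ ‖v‖) (hQ : ∀ v, ‖Q v‖ ≤ ‖v‖)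
    (hPA : ∀ v, P (A v) = 0) (hQA : ∀ v, Q (A v) = A v) {m d K : ℝ} (hm : 0 < m) (hd0 : 0 < d)
    (hK : 0 ≤ K)
    (hA : ∀ v, m * ‖Q v‖ ≤ ‖A v‖) (hB : ∀ u v, ‖B u v‖ ≤ K * ‖u‖ * ‖v‖)
    (hd : ∀ u v, d * ‖P u‖ * ‖P v‖ ≤ ‖P (B (P u) (P v))‖)
    {t : ℝ} (ht : 0 ≤ t) (ht1 : t ≤ 1) (htm : 4 * (K + 1) * t ≤ m)
    (htd : (2 + K + (3 * K + 2) * (4 * (K + 1)) / m) * t ≤ d / 2)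
    {e : E} (hL : ∀ v, ‖L v - A v - B e v‖ ≤ t * ‖e‖ * ‖v‖)
    (heP0 : P e ≠ 0) (heP : ‖P e‖ ≤ t) (heQ : ‖Q e‖ ≤ t * ‖P e‖) :
    Function.Injective L := by
  rw [injective_iff_map_eq_zero]
  intro v hv
  obtain ⟨h1, h2⟩ := perturbed_lower_bound A L P Q B hPQ hP hQ hPA hQA hm hK hA hB hd ht ht1
    htm htd hL heP heQ v
  have ha0 : 0 < ‖P e‖ := norm_pos_iff.2 heP0
  rw [hv, map_zero, map_zero, norm_zero] at *
  have hPv : ‖P v‖ = 0 := by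
    by_contra h
    have : 0 < ‖P v‖ := lt_of_le_of_ne (norm_nonneg _) (Ne.symm h)
    have : 0 < d * ‖P e‖ * ‖P v‖ := by positivity
    linarith
  rw [hPv] at h1
  have hQv : ‖Q v‖ = 0 := by
    by_contra h
    have : 0 < ‖Q v‖ := lt_of_le_of_ne (norm_nonneg _) (Ne.symm h)
    have : 0 < m * ‖Q v‖ := by positivity
    linarith
  rw [← hPQ v, norm_eq_zero.1 hPv, norm_eq_zero.1 hQv, add_zero]

end NewtonAnderson

namespace NewtonAnderson

variable {n : ℕ}

local notation "𝔼" n => EuclideanSpace ℝ (Fin n)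

/-! ### The splitting into kernel and range, and the lower bounds on each part -/

section Projections

variable {f : (𝔼 n) → 𝔼 n} {xs : 𝔼 n}

theorem rangeSp_eq_orthogonal (hortho : rangeSp f xs ⟂ nullSp f xs) :
    rangeSp f xs = (nullSp f xs)ᗮ := by
  refine Submodule.eq_of_le_of_finrank_eq (Submodule.isOrtho_iff_le.1 hortho) ?_
  have h1 := (fderiv ℝ f xs).toLinearMap.finrank_range_add_finrank_ker
  have h2 := (nullSp f xs).finrank_add_finrank_orthogonal
  have h3 : Module.finrank ℝ (rangeSp f xs) + Module.finrank ℝ (nullSp f xs) =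
      Module.finrank ℝ (𝔼 n) := h1
  omega

theorem projN_add_projR (hortho : rangeSp f xs ⟂ nullSp f xs) (v : 𝔼 n) :
    projN f xs v + projR f xs v = v := by
  have h : projR f xs = ((nullSp f xs)ᗮ).starProjection := by
    simp only [projR, rangeSp_eq_orthogonal hortho]
  rw [h, projN]
  exact Submodule.starProjection_add_starProjection_orthogonal v

theorem norm_projN_le (v : 𝔼 n) : ‖projN f xs v‖ ≤ ‖v‖ :=
  Submodule.norm_starProjection_apply_le _ v

theorem norm_projR_le (v : 𝔼 n) : ‖projR f xs v‖ ≤ ‖v‖ :=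
  Submodule.norm_starProjection_apply_le _ v

theorem norm_le_projN_add_projR (hortho : rangeSp f xs ⟂ nullSp f xs) (v : 𝔼 n) :
    ‖v‖ ≤ ‖projN f xs v‖ + ‖projR f xs v‖ := by
  conv_lhs => rw [← projN_add_projR hortho v]
  exact norm_add_le _ _

theorem projR_fderiv (v : 𝔼 n) : projR f xs (fderiv ℝ f xs v) = fderiv ℝ f xs v :=
  Submodule.starProjection_eq_self_iff.2 (LinearMap.mem_range_self _ v)

theorem projN_fderiv (hortho : rangeSp f xs ⟂ nullSp f xs) (v : 𝔼 n) :
    projN f xs (fderiv ℝ f xs v) = 0 := by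
  have h := projN_add_projR hortho (fderiv ℝ f xs v)
  rw [projR_fderiv] at h
  simpa using h

theorem projN_mem (v : 𝔼 n) : projN f xs v ∈ nullSp f xs :=
  Submodule.starProjection_apply_mem _ v

theorem projR_mem (v : 𝔼 n) : projR f xs v ∈ rangeSp f xs :=
  Submodule.starProjection_apply_mem _ v

theorem fderiv_projN (v : 𝔼 n) : fderiv ℝ f xs (projN f xs v) = 0 :=
  LinearMap.mem_ker.1 (projN_mem v)

/-- `R ∩ N = 0` makes `f'(xs)` injective on the finite-dimensional space `R`, hence bounded below
there, and `f'(xs) v` depends only on `P_R v`. -/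
theorem exists_lower_bound_projR (hortho : rangeSp f xs ⟂ nullSp f xs) :
    ∃ m > 0, ∀ v, m * ‖projR f xs v‖ ≤ ‖fderiv ℝ f xs v‖ := by
  let g : rangeSp f xs →ₗ[ℝ] 𝔼 n := (fderiv ℝ f xs).toLinearMap ∘ₗ (rangeSp f xs).subtype
  have hg : LinearMap.ker g = ⊥ := by
    rw [LinearMap.ker_eq_bot']
    rintro ⟨r, hr⟩ h
    have hrN : r ∈ nullSp f xs := h
    exact Subtype.ext (Submodule.disjoint_def.1 hortho.disjoint r hr hrN)
  obtain ⟨K, hK, hanti⟩ := g.exists_antilipschitzWith hg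
  refine ⟨(K : ℝ)⁻¹, by positivity, fun v => ?_⟩
  have h1 := hanti.le_mul_norm (map_zero g) (⟨projR f xs v, projR_mem v⟩ : rangeSp f xs)
  have h2 : g ⟨projR f xs v, projR_mem v⟩ = fderiv ℝ f xs v := by
    conv_rhs => rw [← projN_add_projR hortho v, map_add, fderiv_projN, zero_add]
    rfl
  rw [h2] at h1
  have hK' : (0 : ℝ) < K := hK
  rw [inv_mul_le_iff₀ hK']
  exact h1

/-- Both arguments are multiples of `φ`, so equality holds with `d = ‖P_N f''(xs)(φ, φ)‖ / ‖φ‖ ^ 2`,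
which is nonzero by injectivity of `D̂`. -/
theorem exists_lower_bound_projN (hdim : Module.finrank ℝ (nullSp f xs) = 1) {φ : 𝔼 n}
    (hφ : φ ∈ nullSp f xs) (hφ0 : φ ≠ 0) (hD : Function.Injective (Dhat f xs φ)) :
    ∃ d > 0, ∀ u v, d * ‖projN f xs u‖ * ‖projN f xs v‖ ≤
      ‖projN f xs (fderiv ℝ (fderiv ℝ f) xs (projN f xs u) (projN f xs v))‖ := by
  set B := fderiv ℝ (fderiv ℝ f) xs with hB
  have hφn : 0 < ‖φ‖ := norm_pos_iff.2 hφ0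
  have hne : projN f xs (B φ φ) ≠ 0 := by
    intro h
    have h1 : Dhat f xs φ ⟨φ, hφ⟩ = 0 := Subtype.ext h
    have h2 := (injective_iff_map_eq_zero _).1 hD _ h1
    exact hφ0 (congrArg Subtype.val h2)
  have hspan : ∀ u, ∃ s : ℝ, projN f xs u = s • φ := by
    intro u
    have hφ0' : (⟨φ, hφ⟩ : nullSp f xs) ≠ 0 := fun h => hφ0 (congrArg Subtype.val h)
    obtain ⟨s, hs⟩ := (finrank_eq_one_iff_of_nonzero' _ hφ0').1 hdim ⟨projN f xs u, projN_mem u⟩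
    exact ⟨s, (congrArg Subtype.val hs).symm⟩
  refine ⟨‖projN f xs (B φ φ)‖ / ‖φ‖ ^ 2, by positivity, fun u v => ?_⟩
  obtain ⟨s, hs⟩ := hspan u
  obtain ⟨r, hr⟩ := hspan v
  rw [hs, hr]
  simp only [map_smul, smul_apply, norm_smul]
  apply le_of_eq
  field_simp

end Projections

/-- Newton's method near a singular root: on a small enough cone the derivative is invertible,
the kernel component of the error is halved up to a small relative error, and its range component
becomes quadratically small. -/
theorem exists_newton_estimate {f : (𝔼 n) → 𝔼 n} (hf : ContDiff ℝ 2 f) {xs : 𝔼 n}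
    (hroot : f xs = 0) (hdim : Module.finrank ℝ (nullSp f xs) = 1)
    (hortho : rangeSp f xs ⟂ nullSp f xs) {φ : 𝔼 n} (hφ : φ ∈ nullSp f xs) (hφ0 : φ ≠ 0)
    (hD : Function.Injective (Dhat f xs φ)) {ε : ℝ} (hε0 : 0 < ε) (hε : ε ≤ 1 / 2) :
    ∃ C > 0, ∃ t > 0, ∀ x ∈ region f xs t t, (fderiv ℝ f x).IsInvertible ∧
      ‖projN f xs (x - xs + newtonUpdate f x) - (1 / 2 : ℝ) • projN f xs (x - xs)‖ ≤
        ε * ‖projN f xs (x - xs)‖ ∧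
      ‖projR f xs (x - xs + newtonUpdate f x)‖ ≤ C * ‖x - xs‖ ^ 2 := by
  obtain ⟨m, hm, hA⟩ := exists_lower_bound_projR hortho
  obtain ⟨d, hd0, hd⟩ := exists_lower_bound_projN hdim hφ hφ0 hD
  set A := fderiv ℝ f xs with hAdef
  set B := fderiv ℝ (fderiv ℝ f) xs with hBdef
  set K := max ‖A‖ ‖B‖ with hKdef
  have hK : 0 ≤ K := (norm_nonneg A).trans (le_max_left _ _)
  have hAK : ∀ v, ‖A v‖ ≤ K * ‖v‖ := fun v =>
    (A.le_opNorm v).trans (by gcongr; exact le_max_left _ _)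
  have hBK : ∀ u v, ‖B u v‖ ≤ K * ‖u‖ * ‖v‖ := fun u v =>
    (B.le_opNorm₂ u v).trans (by gcongr; exact le_max_right _ _)
  set c₁ := 2 + K + (3 * K + 2) * (4 * (K + 1)) / m with hc₁
  set c₂ := 12 + 2 * ((6 * K + 4) / m) * (K + 6) with hc₂
  have hc₁0 : 0 < c₁ := by positivity
  have hc₂0 : 0 < c₂ := by positivity
  -- One bound for each smallness condition of `newton_error`; `t` serves as Taylor tolerance,
  -- radius and aperture.
  set t := min (min 1 (m / (4 * (K + 1)))) (min (d / 2 / c₁) (d * ε / c₂)) with htdef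
  have ht0 : 0 < t := by
    simp only [htdef, lt_min_iff]
    refine ⟨⟨one_pos, ?_⟩, ?_, ?_⟩ <;> positivity
  have ht1 : t ≤ 1 := (min_le_left _ _).trans (min_le_left _ _)
  have htm : 4 * (K + 1) * t ≤ m := by
    rw [mul_comm, ← le_div_iff₀ (by positivity)]
    exact (min_le_left _ _).trans (min_le_right _ _)
  have htd : c₁ * t ≤ d / 2 := by
    rw [mul_comm, ← le_div_iff₀ hc₁0]
    exact (min_le_right _ _).trans (min_le_left _ _)
  have htε : c₂ * t ≤ d * ε := by
    rw [mul_comm, ← le_div_iff₀ hc₂0]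
    exact (min_le_right _ _).trans (min_le_right _ _)
  obtain ⟨ρ, hρ, htaylor⟩ := taylor_two hf xs ht0
  refine ⟨(6 * K + 8) / m, by positivity, min t ρ, lt_min ht0 hρ, fun x hx => ?_⟩
  obtain ⟨hxb, hxc⟩ := hx
  have hxb' : ‖x - xs‖ < min t ρ := by simpa [dist_eq_norm] using hxb
  have hxc' : ‖projR f xs (x - xs)‖ < min t ρ * ‖projN f xs (x - xs)‖ := hxc
  have heP0 : projN f xs (x - xs) ≠ 0 := by
    intro h
    rw [h, norm_zero, mul_zero] at hxc'
    exact absurd hxc' (not_lt.2 (norm_nonneg _))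
  have heP : ‖projN f xs (x - xs)‖ ≤ t :=
    (norm_projN_le _).trans (hxb'.le.trans (min_le_left _ _))
  have heQ : ‖projR f xs (x - xs)‖ ≤ t * ‖projN f xs (x - xs)‖ :=
    hxc'.le.trans (by gcongr; exact min_le_left _ _)
  obtain ⟨hT1, hT2⟩ := htaylor x (hxb'.trans_le (min_le_right _ _))
  have hL : ∀ v, ‖fderiv ℝ f x v - A v - B (x - xs) v‖ ≤ t * ‖x - xs‖ * ‖v‖ := fun v =>
    ((fderiv ℝ f x - A - B (x - xs)).le_opNorm v).trans (by gcongr)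
  have hinj := perturbed_injective A (fderiv ℝ f x) (projN f xs) (projR f xs) B
    (projN_add_projR hortho) norm_projN_le norm_projR_le (projN_fderiv hortho) projR_fderiv
    hm hd0 hK hA hBK hd ht0.le ht1 htm htd hL heP0 heP heQ
  have hinv : (fderiv ℝ f x).IsInvertible :=
    ⟨(LinearEquiv.ofInjectiveEndo (fderiv ℝ f x).toLinearMap hinj).toContinuousLinearEquiv, by
      ext v; rfl⟩
  have hw : fderiv ℝ f x (newtonUpdate f x) = -f x := by
    rw [newtonUpdate, map_neg, ← (hinv.inverse_apply_eq).1 rfl]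
  refine ⟨hinv, ?_⟩
  rw [hroot, sub_zero] at hT2
  exact newton_error A (fderiv ℝ f x) (projN f xs) (projR f xs) B
    (projN_add_projR hortho) norm_projN_le norm_projR_le (projN_fderiv hortho) projR_fderiv
    fderiv_projN hm hd0 hK hA hAK hBK hd ht0.le ht1 htm htd hε htε hL hT2 hw heP0 heP heQ

/-! ### The safeguarding factor -/

section Safeguard

variable {rhat : ℝ} (w w' : 𝔼 n)

theorem safeguardTol_nonneg (hr : 0 ≤ rhat) : 0 ≤ safeguardTol rhat w w' := by
  unfold safeguardTol; positivity

theorem safeguardTol_mul_norm_le (hr : 0 ≤ rhat) :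
    safeguardTol rhat w w' * ‖w‖ ≤ rhat * ‖w'‖ := by
  unfold safeguardTol
  have h1 : ‖w'‖ / ‖w‖ * ‖w‖ ≤ ‖w'‖ := by
    rcases eq_or_ne ‖w‖ 0 with h | h
    · simp [h]
    · exact (div_mul_cancel₀ _ h).le
  calc _ = min (‖w'‖ / ‖w‖) rhat * (‖w'‖ / ‖w‖ * ‖w‖) := by ring
    _ ≤ rhat * ‖w'‖ := by gcongr; exact min_le_right _ _

/-- The safeguarding factor lies in `[0, 1]`, and the safeguarded coefficient `μ = λ γ` satisfies
`|μ| ≤ β |1 - μ|`. -/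
theorem safeguardFactor_spec (hr : 0 ≤ rhat) :
    safeguardFactor rhat w w' ∈ Set.Icc (0 : ℝ) 1 ∧
      |safeguardFactor rhat w w' * anderson w w'| ≤
        safeguardTol rhat w w' * |1 - safeguardFactor rhat w w' * anderson w w'| := by
  have hβ := safeguardTol_nonneg w w' hr
  unfold safeguardFactor
  generalize safeguardTol rhat w w' = β at *
  generalize anderson w w' = γ
  split_ifs with h1 h2
  · simpa using hβ
  · push Not at h1
    obtain ⟨hγ0, hγ1⟩ := h1
    rw [abs_of_pos (show 0 < 1 - γ by linarith), lt_div_iff₀ (by linarith)] at h2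
    rcases lt_or_gt_of_ne hγ0 with hneg | hpos
    · rw [Real.sign_of_neg hneg]
      rw [abs_of_neg hneg] at h2
      -- The test reads `β < -γ (1 - β)`, which forces `β < 1`. Then `1 - μ = 1 / (1 - β)`, and the
      -- claim is an equality.
      have hβ1 : β < 1 := by nlinarith
      have hden : 0 < γ * (β + -1) := mul_pos_of_neg_of_neg hneg (by linarith)
      have hμ : β / (γ * (β + -1)) * γ = -(β / (1 - β)) := by
        have h3 : β + -1 ≠ 0 := by linarith
        have h4 : 1 - β ≠ 0 := by linarith
        field_simp
        ring
      refine ⟨⟨by positivity, ?_⟩, ?_⟩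
      · rw [div_le_one hden]; linarith
      · have h4 : 0 < 1 - β := by linarith
        rw [hμ, abs_neg, abs_of_nonneg (by positivity), abs_of_nonneg (by
          have : 0 ≤ β / (1 - β) := by positivity
          linarith)]
        apply le_of_eq
        field_simp
        ring
    · rw [Real.sign_of_pos hpos]
      rw [abs_of_pos hpos] at h2
      have hμ : β / (γ * (β + 1)) * γ = β / (1 + β) := by field_simp; ring
      refine ⟨⟨by positivity, ?_⟩, ?_⟩
      · rw [div_le_one (by positivity)]; linarith
      · have h5 : 1 - β / (1 + β) = 1 / (1 + β) := by field_simp; ring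
        rw [hμ, h5, abs_of_nonneg (by positivity), abs_of_nonneg (by positivity)]
        apply le_of_eq
        ring
  -- Here `λ = 1`, and the claim is the failed test itself.
  · push Not at h1 h2
    refine ⟨⟨zero_le_one, le_rfl⟩, ?_⟩
    rw [one_mul]
    rwa [div_le_iff₀ (abs_pos.2 (by linarith [h1.2]))] at h2

/-- Moving from `0` towards the optimal coefficient does not increase the residual. -/
theorem norm_sub_smul_anderson_le {l : ℝ} (hl : l ∈ Set.Icc (0 : ℝ) 1) :
    ‖w' - (l * anderson w w') • (w' - w)‖ ≤ ‖w'‖ := by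
  refine le_of_sq_le_sq ?_ (norm_nonneg _)
  rw [norm_sub_sq_real, norm_smul, inner_smul_right, real_inner_comm, mul_pow]
  rcases eq_or_ne (w' - w) 0 with h | h
  · simp [h]
  · have hpos : 0 < ‖w' - w‖ ^ 2 := by positivity
    have hγ : inner ℝ (w' - w) w' = anderson w w' * ‖w' - w‖ ^ 2 := by
      unfold anderson; field_simp
    rw [hγ, Real.norm_eq_abs, sq_abs]
    obtain ⟨h0, h1⟩ := hl
    -- The squared norm drops by exactly this quantity.
    have : 0 ≤ l * (2 - l) * anderson w w' ^ 2 * ‖w' - w‖ ^ 2 := by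
      have : 0 ≤ 2 - l := by linarith
      positivity
    nlinarith

end Safeguard

end NewtonAnderson

/-! ### One accelerated step -/

namespace NewtonAnderson

/-- One Anderson step, seen through a projection `P` under which Newton's method halves the error
up to the relative error `ε = (1 - r) / 64`. -/
theorem anderson_step {E : Type*} [NormedAddCommGroup E] [NormedSpace ℝ E] {P : E →L[ℝ] E}
    (hP : ∀ v, ‖P v‖ ≤ ‖v‖) {r ε μ θ : ℝ} (hr0 : 0 < r) (hr1 : r < 1) (hε : ε = (1 - r) / 64)
    {e e' w w' : E}
    (he : ‖P (e + w) - (1 / 2 : ℝ) • P e‖ ≤ ε * ‖P e‖)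
    (he' : ‖P (e' + w') - (1 / 2 : ℝ) • P e'‖ ≤ ε * ‖P e'‖)
    (hw' : ‖w'‖ ≤ (1 / 2 + 2 * ε) * ‖P e'‖) (hw'0 : w' ≠ 0)
    (hμ : |μ| * ‖w‖ ≤ r * |1 - μ| * ‖w'‖) (hθ : θ = ‖w' - μ • (w' - w)‖ / ‖w'‖) :
    |μ| * ‖P e‖ ≤ 3 * (|1 - μ| * ‖P e'‖) ∧
    (1 - r) / 4 * (|1 - μ| * ‖P e'‖) ≤ ‖P ((1 - μ) • (e' + w') + μ • (e + w))‖ ∧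
    ‖P ((1 - μ) • (e' + w') + μ • (e + w))‖ ≤ 3 / 4 * θ * ‖P e'‖ := by
  have hε0 : 0 < ε := by rw [hε]; linarith
  have hε1 : ε ≤ 1 / 64 := by rw [hε]; linarith
  have hw'n : 0 < ‖w'‖ := norm_pos_iff.2 hw'0
  set δ := P (e + w) - (1 / 2 : ℝ) • P e with hδ
  set δ' := P (e' + w') - (1 / 2 : ℝ) • P e' with hδ'
  have hPe : P (e + w) = (1 / 2 : ℝ) • P e + δ := by rw [hδ]; abel
  have hPe' : P (e' + w') = (1 / 2 : ℝ) • P e' + δ' := by rw [hδ']; abel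
  have hhalf : ∀ u : E, ‖(1 / 2 : ℝ) • u‖ = 1 / 2 * ‖u‖ := fun u => by
    rw [norm_smul, Real.norm_of_nonneg (by norm_num)]
  have hwlow : (1 / 2 - ε) * ‖P e‖ ≤ ‖w‖ := by
    have h1 : (1 / 2 : ℝ) • P e = δ - P w := by
      rw [hδ, map_add]; module
    have h2 := norm_sub_le δ (P w)
    rw [← h1, hhalf] at h2
    linarith [hP w]
  set X := |μ| * ‖P e‖ with hX
  set Y := |1 - μ| * ‖P e'‖ with hY
  have hX0 : 0 ≤ X := by positivity
  have hY0 : 0 ≤ Y := by positivity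
  have hXY : X * (1 / 2 - ε) ≤ r * Y * (1 / 2 + 2 * ε) := by
    have h1 : |μ| * ((1 / 2 - ε) * ‖P e‖) ≤ |μ| * ‖w‖ := by gcongr
    have h2 : r * |1 - μ| * ‖w'‖ ≤ r * |1 - μ| * ((1 / 2 + 2 * ε) * ‖P e'‖) := by gcongr
    calc X * (1 / 2 - ε) = |μ| * ((1 / 2 - ε) * ‖P e‖) := by rw [hX]; ring
      _ ≤ _ := h1.trans (hμ.trans h2)
      _ = _ := by rw [hY]; ring
  have hrY : r * Y ≤ Y := by nlinarith
  have hrY0 : 0 ≤ r * Y := by positivity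
  have hX2 : X ≤ 2 * Y := by nlinarith
  have hdec : P ((1 - μ) • (e' + w') + μ • (e + w)) =
      (1 - μ) • P (e' + w') + μ • P (e + w) := by
    rw [map_add, map_smul, map_smul]
  refine ⟨by linarith, ?_, ?_⟩
  · have hv' : (1 / 2 - ε) * ‖P e'‖ ≤ ‖P (e' + w')‖ := by
      have h1 : (1 / 2 : ℝ) • P e' = P (e' + w') - δ' := by rw [hPe']; abel
      have h2 := norm_sub_le (P (e' + w')) δ'
      rw [← h1, hhalf] at h2
      linarith
    have hv : ‖P (e + w)‖ ≤ (1 / 2 + ε) * ‖P e‖ := by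
      rw [hPe]
      have := norm_add_le ((1 / 2 : ℝ) • P e) δ
      rw [hhalf] at this
      linarith
    have h1 : ‖(1 - μ) • P (e' + w')‖ ≤
        ‖P ((1 - μ) • (e' + w') + μ • (e + w))‖ + ‖μ • P (e + w)‖ := by
      rw [hdec]
      simpa using norm_sub_le ((1 - μ) • P (e' + w') + μ • P (e + w)) (μ • P (e + w))
    rw [norm_smul, norm_smul, Real.norm_eq_abs, Real.norm_eq_abs] at h1
    have h2 : (1 / 2 - ε) * Y ≤ |1 - μ| * ‖P (e' + w')‖ := by
      calc _ = |1 - μ| * ((1 / 2 - ε) * ‖P e'‖) := by rw [hY]; ring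
        _ ≤ _ := by gcongr
    have h3 : |μ| * ‖P (e + w)‖ ≤ (1 / 2 + ε) * X := by
      calc _ ≤ |μ| * ((1 / 2 + ε) * ‖P e‖) := by gcongr
        _ = _ := by rw [hX]; ring
    have h4 : ε * X ≤ ε * (2 * Y) := by gcongr
    have h5 : ε * (r * Y) ≤ ε * Y := by gcongr
    -- The total loss is `7 ε Y`, and `1/2 - 7/64 ≥ 1/4`.
    have h6 : (1 - r) / 4 * Y ≤ (1 / 2 - ε) * Y - (r * Y / 2 + 6 * (ε * Y)) := by
      have : 0 ≤ (1 - r) * Y := mul_nonneg (by linarith) hY0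
      rw [hε]; nlinarith
    linarith
  · have hsplit : P ((1 - μ) • (e' + w') + μ • (e + w)) =
        -P (w' - μ • (w' - w)) + (2 : ℝ) • ((1 - μ) • δ' + μ • δ) := by
      rw [hδ, hδ']
      simp only [map_add, map_sub, map_smul]
      module
    have hθw : ‖w' - μ • (w' - w)‖ = θ * ‖w'‖ := by rw [hθ]; field_simp
    have hθ0 : 0 ≤ θ := by rw [hθ]; positivity
    have hθlow : (1 - r) * |1 - μ| ≤ θ := by
      have h1 : (1 - μ) • w' = (w' - μ • (w' - w)) - μ • w := by module
      have h2 := norm_sub_le (w' - μ • (w' - w)) (μ • w)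
      rw [← h1, norm_smul, norm_smul, Real.norm_eq_abs, Real.norm_eq_abs, hθw] at h2
      have h3 : (1 - r) * |1 - μ| * ‖w'‖ ≤ θ * ‖w'‖ := by linarith
      exact le_of_mul_le_mul_right h3 hw'n
    have h1 : ‖P ((1 - μ) • (e' + w') + μ • (e + w))‖ ≤
        θ * ‖w'‖ + 2 * (|1 - μ| * ‖δ'‖ + |μ| * ‖δ‖) := by
      rw [hsplit]
      refine (norm_add_le _ _).trans (add_le_add ?_ ?_)
      · rw [norm_neg]; exact (hP _).trans_eq hθw
      · rw [norm_smul, Real.norm_of_nonneg (by norm_num)]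
        refine mul_le_mul_of_nonneg_left ((norm_add_le _ _).trans_eq ?_) (by norm_num)
        rw [norm_smul, norm_smul, Real.norm_eq_abs, Real.norm_eq_abs]
    have h2 : |1 - μ| * ‖δ'‖ ≤ ε * Y := by
      calc _ ≤ |1 - μ| * (ε * ‖P e'‖) := by gcongr
        _ = _ := by rw [hY]; ring
    have h3 : |μ| * ‖δ‖ ≤ ε * X := by
      calc _ ≤ |μ| * (ε * ‖P e‖) := by gcongr
        _ = _ := by rw [hX]; ring
    have h4 : ε * X ≤ ε * (2 * Y) := by gcongr
    have h5 : θ * ‖w'‖ ≤ θ * ((1 / 2 + 2 * ε) * ‖P e'‖) := by gcongr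
    -- The errors `2 (ε Y + 2 ε Y)` thus cost at most `6/64` of `θ ‖P e'‖`; together with `1/2 +
    -- 2/64` this stays below `3/4`.
    have h6 : 64 * (ε * Y) ≤ θ * ‖P e'‖ := by
      calc 64 * (ε * Y) = (1 - r) * |1 - μ| * ‖P e'‖ := by rw [hε, hY]; ring
        _ ≤ _ := by gcongr
    have h7 : ε * (θ * ‖P e'‖) ≤ 1 / 64 * (θ * ‖P e'‖) := by gcongr
    nlinarith

variable {n : ℕ}

local notation "𝔼" n => EuclideanSpace ℝ (Fin n)

/-- The point produced by one safeguarded Newton–Anderson step from `xp` (older) and `x`. -/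
noncomputable def nextIterate (f : (𝔼 n) → 𝔼 n) (rhat : ℝ) (xp x : 𝔼 n) : 𝔼 n :=
  x + newtonUpdate f x - lamGamma f rhat xp x • (x - xp + newtonUpdate f x - newtonUpdate f xp)

theorem iter_add_two (f : (𝔼 n) → 𝔼 n) (rhat : ℝ) (x0 : 𝔼 n) (k : ℕ) :
    iter f rhat x0 (k + 2) = nextIterate f rhat (iter f rhat x0 k) (iter f rhat x0 (k + 1)) := rfl

theorem nextIterate_sub (f : (𝔼 n) → 𝔼 n) (rhat : ℝ) (xp x xs : 𝔼 n) :
    nextIterate f rhat xp x - xs =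
      (1 - lamGamma f rhat xp x) • (x - xs + newtonUpdate f x) +
        lamGamma f rhat xp x • (xp - xs + newtonUpdate f xp) := by
  unfold nextIterate; module

/-- What is known about the Newton update at a point `x` of a small cone at a singular root `xs`. -/
structure NewtonEstimate (f : (𝔼 n) → 𝔼 n) (xs : 𝔼 n) (ε C : ℝ) (x : 𝔼 n) : Prop where
  isInvertible : (fderiv ℝ f x).IsInvertible
  projN_ne_zero : projN f xs (x - xs) ≠ 0
  norm_le : ‖x - xs‖ ≤ 2 * ‖projN f xs (x - xs)‖
  projN_newton : ‖projN f xs (x - xs + newtonUpdate f x) - (1 / 2 : ℝ) • projN f xs (x - xs)‖ ≤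
    ε * ‖projN f xs (x - xs)‖
  projR_newton : ‖projR f xs (x - xs + newtonUpdate f x)‖ ≤ C * ‖x - xs‖ ^ 2
  update_le : ‖newtonUpdate f x‖ ≤ (1 / 2 + 2 * ε) * ‖projN f xs (x - xs)‖

namespace NewtonEstimate

variable {f : (𝔼 n) → 𝔼 n} {xs x xp : 𝔼 n} {ε C : ℝ}

theorem of_mem_region (hortho : rangeSp f xs ⟂ nullSp f xs) {σ ρ : ℝ} (hσ : σ ≤ 1)
    (hC : 0 ≤ C) (hsmall : σ + 4 * C * ρ ≤ ε) (hx : x ∈ region f xs ρ σ)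
    (hinv : (fderiv ℝ f x).IsInvertible)
    (hN : ‖projN f xs (x - xs + newtonUpdate f x) - (1 / 2 : ℝ) • projN f xs (x - xs)‖ ≤
      ε * ‖projN f xs (x - xs)‖)
    (hR : ‖projR f xs (x - xs + newtonUpdate f x)‖ ≤ C * ‖x - xs‖ ^ 2) :
    NewtonEstimate f xs ε C x := by
  obtain ⟨hxb, hxc⟩ := hx
  replace hxb : ‖x - xs‖ < ρ := by simpa [dist_eq_norm] using hxb
  replace hxc : ‖projR f xs (x - xs)‖ < σ * ‖projN f xs (x - xs)‖ := hxc
  have hN0 : projN f xs (x - xs) ≠ 0 := by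
    intro h
    rw [h, norm_zero, mul_zero] at hxc
    exact absurd hxc (not_lt.2 (norm_nonneg _))
  have hn := norm_le_projN_add_projR hortho (x - xs)
  have hle : ‖x - xs‖ ≤ 2 * ‖projN f xs (x - xs)‖ := by
    have : σ * ‖projN f xs (x - xs)‖ ≤ 1 * ‖projN f xs (x - xs)‖ := by gcongr
    linarith
  refine ⟨hinv, hN0, hle, hN, hR, ?_⟩
  set e := x - xs
  set w := newtonUpdate f x
  have h1 : w = (projN f xs (e + w) - (1 / 2 : ℝ) • projN f xs e) + projR f xs (e + w)
      - (1 / 2 : ℝ) • projN f xs e - projR f xs e := by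
    have h2 := projN_add_projR hortho (e + w)
    have h3 := projN_add_projR hortho e
    calc w = (e + w) - e := by abel
      _ = (projN f xs (e + w) + projR f xs (e + w)) - (projN f xs e + projR f xs e) := by
        rw [h2, h3]
      _ = _ := by module
  have h2 : ‖w‖ ≤ ‖projN f xs (e + w) - (1 / 2 : ℝ) • projN f xs e‖ + ‖projR f xs (e + w)‖
      + 1 / 2 * ‖projN f xs e‖ + ‖projR f xs e‖ := by
    have h3 : ‖(1 / 2 : ℝ) • projN f xs e‖ = 1 / 2 * ‖projN f xs e‖ := by
      rw [norm_smul, Real.norm_of_nonneg (by norm_num)]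
    refine (congrArg norm h1).trans_le ((norm_sub_le _ _).trans ?_)
    gcongr
    refine (norm_sub_le _ _).trans ?_
    rw [h3]
    gcongr
    exact norm_add_le _ _
  have hρ0 : 0 ≤ ρ := (norm_nonneg _).trans hxb.le
  have h3 : C * ‖e‖ ^ 2 ≤ 4 * C * ρ * ‖projN f xs e‖ := by
    have h4 : ‖e‖ ^ 2 ≤ ρ * (2 * ‖projN f xs e‖) := by
      rw [sq]; gcongr
    have h5 : C * ‖e‖ ^ 2 ≤ C * (ρ * (2 * ‖projN f xs e‖)) := by gcongr
    have h6 : 0 ≤ C * ρ * ‖projN f xs e‖ := by positivity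
    linarith
  have h4 : (σ + 4 * C * ρ) * ‖projN f xs e‖ ≤ ε * ‖projN f xs e‖ := by gcongr
  linarith

theorem projN_pos (h : NewtonEstimate f xs ε C x) : 0 < ‖projN f xs (x - xs)‖ :=
  norm_pos_iff.2 h.projN_ne_zero

theorem le_update (h : NewtonEstimate f xs ε C x) :
    (1 / 2 - ε) * ‖projN f xs (x - xs)‖ ≤ ‖newtonUpdate f x‖ := by
  have h1 : (1 / 2 : ℝ) • projN f xs (x - xs) =
      (projN f xs (x - xs + newtonUpdate f x) - (1 / 2 : ℝ) • projN f xs (x - xs))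
        - projN f xs (newtonUpdate f x) := by
    rw [map_add]; module
  have h2 := (congrArg norm h1).trans_le (norm_sub_le _ _)
  rw [norm_smul, Real.norm_of_nonneg (by norm_num)] at h2
  linarith [h.projN_newton, norm_projN_le (f := f) (xs := xs) (newtonUpdate f x)]

theorem update_ne_zero (h : NewtonEstimate f xs ε C x) (hε : ε < 1 / 2) :
    newtonUpdate f x ≠ 0 := by
  rw [← norm_pos_iff]
  exact (mul_pos (by linarith) h.projN_pos).trans_le h.le_update

/-- The updates differ in norm: `3/4 (1/2 + 2 ε) < 1/2 - ε`. This keeps the denominator of `γ` from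
vanishing. -/
theorem update_ne (hp : NewtonEstimate f xs ε C xp) (h : NewtonEstimate f xs ε C x)
    (hε0 : 0 ≤ ε) (hε : ε ≤ 1 / 64)
    (hle : ‖projN f xs (x - xs)‖ ≤ 3 / 4 * ‖projN f xs (xp - xs)‖) :
    newtonUpdate f x ≠ newtonUpdate f xp := by
  intro heq
  have h1 := heq ▸ h.update_le
  have h2 := hp.le_update
  nlinarith [hp.projN_pos, h.projN_pos]

/-- The first, undamped, Newton step. -/
theorem newton_step (h : NewtonEstimate f xs ε C x) (hε : ε ≤ 1 / 64) (hC : 0 ≤ C) :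
    1 / 4 * ‖projN f xs (x - xs)‖ ≤ ‖projN f xs (x - xs + newtonUpdate f x)‖ ∧
    ‖projN f xs (x - xs + newtonUpdate f x)‖ ≤ 3 / 4 * ‖projN f xs (x - xs)‖ ∧
    ‖projR f xs (x - xs + newtonUpdate f x)‖ ≤
      8 * C * ‖x - xs‖ * ‖projN f xs (x - xs + newtonUpdate f x)‖ := by
  have hN := h.projN_newton
  have hpos := h.projN_pos
  have h1 := norm_sub_norm_le ((1 / 2 : ℝ) • projN f xs (x - xs))
    (projN f xs (x - xs + newtonUpdate f x))
  have h2 := norm_sub_norm_le (projN f xs (x - xs + newtonUpdate f x))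
    ((1 / 2 : ℝ) • projN f xs (x - xs))
  rw [norm_sub_rev] at h1
  rw [norm_smul, Real.norm_of_nonneg (by norm_num)] at h1 h2
  have hlow : 1 / 4 * ‖projN f xs (x - xs)‖ ≤ ‖projN f xs (x - xs + newtonUpdate f x)‖ := by
    nlinarith
  refine ⟨hlow, by nlinarith, h.projR_newton.trans ?_⟩
  have h3 : ‖x - xs‖ ≤ 8 * ‖projN f xs (x - xs + newtonUpdate f x)‖ := by
    linarith [h.norm_le]
  calc C * ‖x - xs‖ ^ 2 = C * ‖x - xs‖ * ‖x - xs‖ := by ring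
    _ ≤ C * ‖x - xs‖ * (8 * ‖projN f xs (x - xs + newtonUpdate f x)‖) := by gcongr
    _ = _ := by ring

/-- One safeguarded Newton–Anderson step. -/
theorem nextIterate_step {rhat M : ℝ} (hr0 : 0 < rhat) (hr1 : rhat < 1)
    (hε : ε = (1 - rhat) / 64) (hC : 0 ≤ C)
    (hp : NewtonEstimate f xs ε C xp) (h : NewtonEstimate f xs ε C x)
    (hMp : ‖xp - xs‖ ≤ M) (hM : ‖x - xs‖ ≤ M) :
    projN f xs (nextIterate f rhat xp x - xs) ≠ 0 ∧
    ‖projN f xs (nextIterate f rhat xp x - xs)‖ ≤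
      3 / 4 * gain f rhat xp x * ‖projN f xs (x - xs)‖ ∧
    gain f rhat xp x ≤ 1 ∧
    ‖projR f xs (nextIterate f rhat xp x - xs)‖ ≤ 2 * C * max
      (|1 - lamGamma f rhat xp x| * ‖x - xs‖ ^ 2) (|lamGamma f rhat xp x| * ‖xp - xs‖ ^ 2) ∧
    ‖projR f xs (nextIterate f rhat xp x - xs)‖ ≤
      32 * C / (1 - rhat) * M * ‖projN f xs (nextIterate f rhat xp x - xs)‖ := by
  have hε1 : ε < 1 / 2 := by rw [hε]; linarith
  have hw0 := h.update_ne_zero hε1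
  have hwn : 0 < ‖newtonUpdate f x‖ := norm_pos_iff.2 hw0
  obtain ⟨hl, hβ⟩ := safeguardFactor_spec (newtonUpdate f xp) (newtonUpdate f x) hr0.le
  set μ := lamGamma f rhat xp x with hμdef
  replace hβ : |μ| ≤ safeguardTol rhat (newtonUpdate f xp) (newtonUpdate f x) * |1 - μ| := hβ
  have hμ : |μ| * ‖newtonUpdate f xp‖ ≤ rhat * |1 - μ| * ‖newtonUpdate f x‖ := by
    have h1 := safeguardTol_mul_norm_le (newtonUpdate f xp) (newtonUpdate f x) hr0.le
    calc |μ| * ‖newtonUpdate f xp‖ ≤ safeguardTol rhat (newtonUpdate f xp) (newtonUpdate f x)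
          * |1 - μ| * ‖newtonUpdate f xp‖ := by gcongr
      _ = |1 - μ| * (safeguardTol rhat (newtonUpdate f xp) (newtonUpdate f x)
          * ‖newtonUpdate f xp‖) := by ring
      _ ≤ |1 - μ| * (rhat * ‖newtonUpdate f x‖) := by gcongr
      _ = _ := by ring
  -- If `μ = 1`, the safeguard bound would force `μ = 0`.
  have hμ1 : 0 < |1 - μ| := by
    rw [abs_pos]
    intro h0
    rw [h0, abs_zero, mul_zero] at hβ
    have h1 : μ = 0 := abs_nonpos_iff.1 hβ
    rw [h1] at h0
    norm_num at h0
  have hgain : gain f rhat xp x ≤ 1 := by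
    rw [gain, div_le_one hwn]
    exact norm_sub_smul_anderson_le _ _ hl
  obtain ⟨hX, hlow, hup⟩ := anderson_step norm_projN_le hr0 hr1 hε hp.projN_newton h.projN_newton
    h.update_le hw0 hμ (θ := gain f rhat xp x) rfl
  rw [← nextIterate_sub] at hlow hup
  have hYpos : 0 < |1 - μ| * ‖projN f xs (x - xs)‖ := mul_pos hμ1 h.projN_pos
  have hr' : 0 < 1 - rhat := by linarith
  have hR : ‖projR f xs (nextIterate f rhat xp x - xs)‖ ≤
      |1 - μ| * (C * ‖x - xs‖ ^ 2) + |μ| * (C * ‖xp - xs‖ ^ 2) := by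
    rw [nextIterate_sub, map_add, map_smul, map_smul]
    refine (norm_add_le _ _).trans ?_
    rw [norm_smul, norm_smul, Real.norm_eq_abs, Real.norm_eq_abs]
    gcongr
    · exact h.projR_newton
    · exact hp.projR_newton
  refine ⟨?_, hup, hgain, ?_, ?_⟩
  · rw [← norm_pos_iff]
    exact (mul_pos (by linarith) hYpos).trans_le hlow
  · have h1 := mul_le_mul_of_nonneg_left
      (le_max_left (|1 - μ| * ‖x - xs‖ ^ 2) (|μ| * ‖xp - xs‖ ^ 2)) hC
    have h2 := mul_le_mul_of_nonneg_left
      (le_max_right (|1 - μ| * ‖x - xs‖ ^ 2) (|μ| * ‖xp - xs‖ ^ 2)) hC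
    linarith
  · have hM0 : 0 ≤ M := (norm_nonneg _).trans hM
    have h1 : ‖x - xs‖ ^ 2 ≤ M * (2 * ‖projN f xs (x - xs)‖) := by
      rw [sq]; gcongr; exact h.norm_le
    have h2 : ‖xp - xs‖ ^ 2 ≤ M * (2 * ‖projN f xs (xp - xs)‖) := by
      rw [sq]; gcongr; exact hp.norm_le
    have h3 : |1 - μ| * (C * ‖x - xs‖ ^ 2) ≤
        |1 - μ| * (C * (M * (2 * ‖projN f xs (x - xs)‖))) := by gcongr
    have h4 : |μ| * (C * ‖xp - xs‖ ^ 2) ≤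
        |μ| * (C * (M * (2 * ‖projN f xs (xp - xs)‖))) := by gcongr
    have h5 : 2 * C * M * (|μ| * ‖projN f xs (xp - xs)‖) ≤
        2 * C * M * (3 * (|1 - μ| * ‖projN f xs (x - xs)‖)) := by gcongr
    -- The range part is at most `(2 + 6) C M |1 - μ| ‖P e'‖`; dividing by the kernel factor `(1 -
    -- rhat) / 4` produces `32 C / (1 - rhat)`.
    have h6 : 32 * C / (1 - rhat) * M * ((1 - rhat) / 4 * (|1 - μ| * ‖projN f xs (x - xs)‖)) ≤
        32 * C / (1 - rhat) * M * ‖projN f xs (nextIterate f rhat xp x - xs)‖ := by gcongr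
    have h7 : 32 * C / (1 - rhat) * M * ((1 - rhat) / 4 * (|1 - μ| * ‖projN f xs (x - xs)‖)) =
        8 * C * M * (|1 - μ| * ‖projN f xs (x - xs)‖) := by field_simp; ring
    linarith

end NewtonEstimate

/-- A point whose error has contracted and whose range component is relatively of size `K M`
lies in the region, at distance at most `M`, with aperture at most `K M`. -/
theorem mem_region_of_step {f : (𝔼 n) → 𝔼 n} {xs x : 𝔼 n}
    (hortho : rangeSp f xs ⟂ nullSp f xs) {K M a ρ σ : ℝ} (hσ : σ ≤ 1 / 3) (hKρ : K * ρ ≤ σ)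
    (hK : 0 < K) (hMρ : M < ρ) (haM : a ≤ M) (hx0 : projN f xs (x - xs) ≠ 0)
    (hxN : ‖projN f xs (x - xs)‖ ≤ 3 / 4 * a)
    (hxR : ‖projR f xs (x - xs)‖ ≤ K * M * ‖projN f xs (x - xs)‖) :
    x ∈ region f xs ρ σ ∧ ‖x - xs‖ ≤ M ∧ sigma f xs x ≤ K * M := by
  have hpos : 0 < ‖projN f xs (x - xs)‖ := norm_pos_iff.2 hx0
  have hKM : K * M < σ := (mul_lt_mul_of_pos_left hMρ hK).trans_le hKρ
  have hc : ‖projR f xs (x - xs)‖ < σ * ‖projN f xs (x - xs)‖ :=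
    hxR.trans_lt (mul_lt_mul_of_pos_right hKM hpos)
  -- Here `σ ≤ 1/3` matters: `(1 + 1/3) * (3/4) = 1`.
  have hM : ‖x - xs‖ ≤ M := by
    have h1 := norm_le_projN_add_projR hortho (x - xs)
    nlinarith
  refine ⟨⟨by simpa [dist_eq_norm] using hM.trans_lt hMρ, hc⟩, hM, ?_⟩
  rw [sigma, div_le_iff₀ hpos]
  exact hxR

theorem region_mono {f : (𝔼 n) → 𝔼 n} {xs : 𝔼 n} {ρ ρ' s s' : ℝ} (hρ : ρ ≤ ρ') (hs : s ≤ s') :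
    region f xs ρ s ⊆ region f xs ρ' s' := fun _ hy =>
  ⟨Metric.ball_subset_ball hρ hy.1, hy.2.trans_le (mul_le_mul_of_nonneg_right hs (norm_nonneg _))⟩

end NewtonAnderson

/-! ### The main theorem: choice of constants and induction -/

theorem theorem3p2 {n : ℕ}
    (f : EuclideanSpace ℝ (Fin n) → EuclideanSpace ℝ (Fin n)) (hf : ContDiff ℝ 3 f)
    (xs : EuclideanSpace ℝ (Fin n)) (hroot : f xs = 0)
    (hdim : Module.finrank ℝ (NewtonAnderson.nullSp f xs) = 1)
    (hortho : NewtonAnderson.rangeSp f xs ⟂ NewtonAnderson.nullSp f xs)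
    (φ : EuclideanSpace ℝ (Fin n)) (hφ : φ ∈ NewtonAnderson.nullSp f xs) (hφ0 : φ ≠ 0)
    (hD : Function.Bijective (NewtonAnderson.Dhat f xs φ))
    (rhat : ℝ) (hr0 : 0 < rhat) (hr1 : rhat < 1) :
    ∃ σhat > 0, ∃ ρhat > 0, ∃ C > 0, ∃ κ ∈ Set.Ioo (1 / 2 : ℝ) 1, ∃ c > 0,
      (∀ x ∈ NewtonAnderson.region f xs ρhat σhat, (fderiv ℝ f x).IsInvertible) ∧
      ∀ x0 : EuclideanSpace ℝ (Fin n),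
        NewtonAnderson.projN f xs (x0 - xs) ≠ 0 →
        NewtonAnderson.sigma f xs x0 < σhat →
        ‖x0 - xs‖ < ρhat →
        ∀ x : ℕ → EuclideanSpace ℝ (Fin n), x = NewtonAnderson.iter f rhat x0 →
          -- the iteration is well defined: derivatives are invertible, no denominator vanishes
          (∀ k, x k ∈ NewtonAnderson.region f xs ρhat σhat ∧
            (fderiv ℝ f (x k)).IsInvertible ∧
            NewtonAnderson.projN f xs (x k - xs) ≠ 0 ∧
            NewtonAnderson.newtonUpdate f (x k) ≠ 0 ∧
            NewtonAnderson.newtonUpdate f (x (k + 1)) ≠ NewtonAnderson.newtonUpdate f (x k)) ∧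
          -- the sets `W_{k+1}` stay in the ball of radius `‖e_0‖` and in the cone of aperture `σhat`
          (∀ k, NewtonAnderson.regionAt f xs (x (k + 1)) ⊆
            NewtonAnderson.region f xs ‖x0 - xs‖ σhat) ∧
          -- `W_{k+1} ⊆ W_0` as soon as `‖e_0‖` is small relative to `σ_0`
          (‖x0 - xs‖ ≤ c * NewtonAnderson.sigma f xs x0 →
            ∀ k, NewtonAnderson.regionAt f xs (x (k + 1)) ⊆ NewtonAnderson.regionAt f xs x0) ∧
          Tendsto x atTop (𝓝 xs) ∧
          -- the two estimates; the step from `x_{k+1}` (and `x_k`) to `x_{k+2}`, for all `k ≥ 0`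
          (∀ k, ‖NewtonAnderson.projR f xs (x (k + 2) - xs)‖ ≤
            C * max
              (|1 - NewtonAnderson.lamGamma f rhat (x k) (x (k + 1))| * ‖x (k + 1) - xs‖ ^ 2)
              (|NewtonAnderson.lamGamma f rhat (x k) (x (k + 1))| * ‖x k - xs‖ ^ 2)) ∧
          (∀ k, ‖NewtonAnderson.projN f xs (x (k + 2) - xs)‖ ≤
            κ * NewtonAnderson.gain f rhat (x k) (x (k + 1)) *
              ‖NewtonAnderson.projN f xs (x (k + 1) - xs)‖) := by
  set ε := (1 - rhat) / 64 with hε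
  have hε0 : 0 < ε := by rw [hε]; linarith
  have hε1 : ε ≤ 1 / 64 := by rw [hε]; linarith
  obtain ⟨C, hC, t, ht, hnewton⟩ := NewtonAnderson.exists_newton_estimate
    (hf.of_le (by norm_num)) hroot hdim hortho hφ hφ0 hD.injective hε0 (by linarith)
  have hr' : 0 < 1 - rhat := by linarith
  set K := 32 * C / (1 - rhat) with hKdef
  have hK : 0 < K := by positivity
  -- This lets the undamped first step satisfy the same aperture bound `K M` as the later ones.
  have h8K : 8 * C ≤ K := by
    rw [hKdef, le_div_iff₀ hr']; nlinarith
  set σhat := min t (min (1 / 3) (ε / 2)) with hσdef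
  have hσ0 : 0 < σhat := by
    simp only [hσdef, lt_min_iff]
    exact ⟨ht, by norm_num, by positivity⟩
  have hσt : σhat ≤ t := min_le_left _ _
  have hσ3 : σhat ≤ 1 / 3 := (min_le_right _ _).trans (min_le_left _ _)
  have hσε : σhat ≤ ε / 2 := (min_le_right _ _).trans (min_le_right _ _)
  set ρhat := min t (min (ε / 2 / (4 * C)) (σhat / K)) with hρdef
  have hρ0 : 0 < ρhat := by
    simp only [hρdef, lt_min_iff]
    exact ⟨ht, by positivity, by positivity⟩
  have hρt : ρhat ≤ t := min_le_left _ _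
  have hρε : 4 * C * ρhat ≤ ε / 2 := by
    rw [mul_comm, ← le_div_iff₀ (by positivity)]
    exact (min_le_right _ _).trans (min_le_left _ _)
  have hKρ : K * ρhat ≤ σhat := by
    rw [mul_comm, ← le_div_iff₀ hK]
    exact (min_le_right _ _).trans (min_le_right _ _)
  have hest : ∀ x ∈ NewtonAnderson.region f xs ρhat σhat,
      NewtonAnderson.NewtonEstimate f xs ε C x := fun x hx => by
    obtain ⟨h1, h2, h3⟩ := hnewton x (NewtonAnderson.region_mono hρt hσt hx)
    exact .of_mem_region hortho (by linarith) hC.le (by linarith) hx h1 h2 h3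
  -- With `c = 1 / K`, the smallness condition is `K ‖e_0‖ ≤ σ_0`, so the uniform aperture bound
  -- yields `W_{k+1} ⊆ W_0`.
  refine ⟨σhat, hσ0, ρhat, hρ0, 2 * C, by positivity, 3 / 4, by norm_num, 1 / K, by positivity,
    fun x hx => (hest x hx).isInvertible, ?_⟩
  intro x0 hx0N hx0σ hx0ρ x hx
  have hx_zero : x 0 = x0 := by rw [hx]; rfl
  have hx_one : x 1 = x 0 + NewtonAnderson.newtonUpdate f (x 0) := by rw [hx]; rfl
  have hx_two : ∀ k, x (k + 2) = NewtonAnderson.nextIterate f rhat (x k) (x (k + 1)) := by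
    intro k; rw [hx]; exact NewtonAnderson.iter_add_two _ _ _ _
  set M := ‖x0 - xs‖ with hMdef
  have hmem0 : x 0 ∈ NewtonAnderson.region f xs ρhat σhat := by
    rw [hx_zero]
    refine ⟨by simpa [dist_eq_norm] using hx0ρ, ?_⟩
    exact (div_lt_iff₀ (norm_pos_iff.2 hx0N)).1 hx0σ
  have hM0 : ‖x 0 - xs‖ ≤ M := by rw [hx_zero]
  -- Two consecutive points are carried, as the recursion needs both. The bound `K M` starts at
  -- index `1`, since the starting aperture is only below `σhat`.
  have hind : ∀ k, (x k ∈ NewtonAnderson.region f xs ρhat σhat ∧ ‖x k - xs‖ ≤ M) ∧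
      (x (k + 1) ∈ NewtonAnderson.region f xs ρhat σhat ∧ ‖x (k + 1) - xs‖ ≤ M ∧
        NewtonAnderson.sigma f xs (x (k + 1)) ≤ K * M) ∧
      ‖NewtonAnderson.projN f xs (x (k + 1) - xs)‖ ≤
        3 / 4 * ‖NewtonAnderson.projN f xs (x k - xs)‖ := by
    intro k
    induction k with
    | zero =>
      have h0 := hest _ hmem0
      obtain ⟨hlow, hup, hR⟩ := h0.newton_step hε1 hC.le
      have hsub : x 1 - xs = x 0 - xs + NewtonAnderson.newtonUpdate f (x 0) := by
        rw [hx_one]; abel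
      rw [← hsub] at hlow hup hR
      refine ⟨⟨hmem0, hM0⟩, NewtonAnderson.mem_region_of_step hortho hσ3 hKρ hK hx0ρ
        ((NewtonAnderson.norm_projN_le _).trans hM0) ?_ hup (hR.trans ?_), hup⟩
      · rw [← norm_pos_iff]
        linarith [h0.projN_pos]
      · rw [hx_zero]
        gcongr
    | succ k ih =>
      obtain ⟨⟨hk, hkM⟩, ⟨hk1, hk1M, -⟩, -⟩ := ih
      obtain ⟨hne, hup, hgain, -, hR⟩ :=
        (hest _ hk).nextIterate_step hr0 hr1 hε hC.le (hest _ hk1) hkM hk1M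
      rw [← hx_two] at hne hup hR
      have hup' : ‖NewtonAnderson.projN f xs (x (k + 2) - xs)‖ ≤
          3 / 4 * ‖NewtonAnderson.projN f xs (x (k + 1) - xs)‖ := by
        refine hup.trans ?_
        gcongr
        linarith
      exact ⟨⟨hk1, hk1M⟩, NewtonAnderson.mem_region_of_step hortho hσ3 hKρ hK hx0ρ
        ((NewtonAnderson.norm_projN_le _).trans hk1M) hne hup' hR, hup'⟩
  have hstep := fun k => (hest _ (hind k).1.1).nextIterate_step hr0 hr1 hε hC.le
    (hest _ (hind k).2.1.1) (hind k).1.2 (hind k).2.1.2.1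
  refine ⟨fun k => ?_, fun k => ?_, fun hc k => ?_, ?_, fun k => ?_, fun k => ?_⟩
  · obtain ⟨⟨hk, -⟩, ⟨hk1, -⟩, hle⟩ := hind k
    exact ⟨hk, (hest _ hk).isInvertible, (hest _ hk).projN_ne_zero,
      (hest _ hk).update_ne_zero (by linarith),
      (hest _ hk).update_ne (hest _ hk1) hε0.le hε1 hle⟩
  · obtain ⟨-, ⟨-, hM, hσ⟩, -⟩ := hind k
    refine NewtonAnderson.region_mono hM (hσ.trans ?_)
    exact (mul_le_mul_of_nonneg_left hx0ρ.le hK.le).trans hKρ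
  · obtain ⟨-, ⟨-, hM, hσ⟩, -⟩ := hind k
    refine NewtonAnderson.region_mono hM (hσ.trans ?_)
    rwa [one_div, ← div_eq_inv_mul, le_div_iff₀ hK, mul_comm] at hc
  -- In the cone `‖e_k‖ ≤ 2 ‖P_N e_k‖`, so geometric decay of the kernel part suffices.
  · have hgeom : ∀ k, ‖NewtonAnderson.projN f xs (x k - xs)‖ ≤ (3 / 4) ^ k * M := by
      intro k
      induction k with
      | zero => simpa using (NewtonAnderson.norm_projN_le _).trans hM0
      | succ k ih =>
        rw [pow_succ]
        linarith [(hind k).2.2]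
    rw [tendsto_iff_norm_sub_tendsto_zero]
    refine squeeze_zero (g := fun k : ℕ => 2 * ((3 / 4 : ℝ) ^ k * M)) (fun _ => norm_nonneg _)
      (fun k => ?_) ?_
    · linarith [(hest _ (hind k).1.1).norm_le, hgeom k]
    · have := ((tendsto_pow_atTop_nhds_zero_of_lt_one (r := (3 / 4 : ℝ)) (by norm_num)
        (by norm_num)).mul_const M).const_mul 2
      simpa using this
  · rw [hx_two]
    exact (hstep k).2.2.2.1
  · rw [hx_two]
    exact (hstep k).2.1
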